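/- Let $R$ be an $n\times n$ expanding integer matrix (all complex eigenvalues have modulus $>1$), and let $\mathcal D\subset\mathbb Z^n$ be a set with $0\in\mathcal D$ and $\#\mathcal D=|\det R|$. Suppose that $T(R,\mathcal D)$, the unique non-empty compact set $T\subset\mathbb R^n$ with $T=\bigcup_{d\in\mathcal D}R^{-1}(T+d)$, is an (integral) self-affine tile, i.e. has non-empty interior. For $k\ge1$ put $\mathcal D_k=\mathcal D+R\mathcal D+\cdots+R^{k-1}\mathcal D$; put $\mathcal J_0^*=\mathbb Z^n$ and $\mathcal J_k^*=R\mathcal J_{k-1}^*+\mathcal D$ for $k\ge1$. For a nonsingular integer matrix $M$, a set $\mathcal J$ is called full-periodic with period $M$ if $\mathcal J=M\mathbb Z^n+C$ for some finite set $C\subset\mathbb Z^n$. A set $\mathcal E\subset\mathbb Z^n$ with $\#\mathcal E=|\det M|$ is said to be of skew-product-form with respect to $M$ if there are a finite set $\mathcal A=\{a_0,\dots,a_{s-1}\}\subset\mathbb Z^n$ of $s$ distinct elements and sets $\mathcal B_0,\dots,\mathcal B_{s-1}\subset\mathbb Z^n$ with $\mathcal E=\bigcup_{j=0}^{s-1}(a_j+M\mathcal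 B_j)$ such that, for every $j$, the sum $\mathcal A+\mathcal B_j$ is direct and is a complete residue set modulo $M$ (it contains exactly one element of each class of $\mathbb Z^n/M\mathbb Z^n$). Then the following are equivalent: (i) there exist an integer $m\ge1$ and a full-periodic set $\mathcal J$ with period $R^m$ such that $0\in\mathcal J$ and $\mathcal J=R^m\mathcal J+\mathcal D_m$; (ii) there exists an integer $m\ge1$ such that $\mathcal D_m$ is of skew-product-form with respect to $R^m$; (iii) there exists an integer $m\ge1$ such that $\mathcal J_{m+1}^*=\mathcal J_m^*$. -/

import Mathlib

open scoped Pointwise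

namespace SelfAffine

/-- An integer matrix is expanding if all its (complex) eigenvalues have modulus `> 1`. -/
def IsExpanding {n : ℕ} (R : Matrix (Fin n) (Fin n) ℤ) : Prop :=
  ∀ μ : ℂ, Module.End.HasEigenvalue (Matrix.toLin' (R.map (Int.cast : ℤ → ℂ))) μ → 1 < ‖μ‖

/-- The affine map `φ_d (x) = R⁻¹ (x + d)` of `ℝⁿ`. -/
noncomputable def ifsMap {n : ℕ} (R : Matrix (Fin n) (Fin n) ℤ) (d : Fin n → ℤ)
    (x : Fin n → ℝ) : Fin n → ℝ :=
  (R.map (Int.cast : ℤ → ℝ))⁻¹.mulVec (x + fun i => (d i : ℝ))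

/-- `T` is the attractor `T(R, D)`: a non-empty compact set with `T = ⋃_{d ∈ D} φ_d (T)`.
For expanding `R` and non-empty `D` there is exactly one such set. -/
def IsAttractor {n : ℕ} (R : Matrix (Fin n) (Fin n) ℤ) (D : Finset (Fin n → ℤ))
    (T : Set (Fin n → ℝ)) : Prop :=
  T.Nonempty ∧ IsCompact T ∧ T = ⋃ d ∈ D, ifsMap R d '' T

/-- `T(R, D)` is an (integral) self-affine tile: the attractor has non-empty interior. -/
def IsSelfAffineTile {n : ℕ} (R : Matrix (Fin n) (Fin n) ℤ) (D : Finset (Fin n → ℤ)) : Prop :=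
  ∃ T : Set (Fin n → ℝ), IsAttractor R D T ∧ (interior T).Nonempty

/-- `D_k = D + R D + ⋯ + R^{k-1} D` (sumset). -/
def digitSum {n : ℕ} (R : Matrix (Fin n) (Fin n) ℤ) (D : Finset (Fin n → ℤ)) (k : ℕ) :
    Finset (Fin n → ℤ) :=
  ∑ i ∈ Finset.range k, D.image (R ^ i).mulVec

/-- `S` is a complete residue set modulo `R`: it contains exactly one representative of every
class of `ℤⁿ / R ℤⁿ`. -/
def IsCompleteResidueSet {n : ℕ} (R : Matrix (Fin n) (Fin n) ℤ) (S : Finset (Fin n → ℤ)) : Prop :=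
  ∀ x : Fin n → ℤ, ∃! s : Fin n → ℤ, s ∈ S ∧ ∃ y : Fin n → ℤ, x = s + R.mulVec y

/-- The sum `A + B` is direct (`A ⊕ B`): every element is `a + b` in only one way. -/
def IsDirectSum {n : ℕ} (A B : Finset (Fin n → ℤ)) : Prop :=
  ∀ a ∈ A, ∀ a' ∈ A, ∀ b ∈ B, ∀ b' ∈ B, a + b = a' + b' → a = a' ∧ b = b'

/-- `D` is an `m`-stage skew-product-form digit set with respect to `R`:
`D = ⋃_{a ∈ A} (a + R^m B_a)` with each `A ⊕ B_a` a complete residue set modulo `R`. -/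
def IsStageSkewProductForm {n : ℕ} (m : ℕ) (R : Matrix (Fin n) (Fin n) ℤ)
    (D : Finset (Fin n → ℤ)) : Prop :=
  D.card = R.det.natAbs ∧
  ∃ (A : Finset (Fin n → ℤ)) (B : (Fin n → ℤ) → Finset (Fin n → ℤ)),
    D = A.biUnion (fun a => (B a).image fun b => a + (R ^ m).mulVec b) ∧
    ∀ a ∈ A, IsDirectSum A (B a) ∧ IsCompleteResidueSet R (A + B a)

/-- A skew-product-form digit set is a `1`-stage skew-product-form digit set. -/
def IsSkewProductForm {n : ℕ} (R : Matrix (Fin n) (Fin n) ℤ) (D : Finset (Fin n → ℤ)) : Prop :=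
  IsStageSkewProductForm 1 R D

/-- `J = M ℤⁿ + C` for a finite set `C ⊆ ℤⁿ`, with `M` a nonsingular integer matrix. (Such a set
automatically lies in `ℤⁿ`.) -/
def IsFullPeriodic {n : ℕ} (M : Matrix (Fin n) (Fin n) ℤ) (J : Set (Fin n → ℤ)) : Prop :=
  M.det ≠ 0 ∧ ∃ C : Finset (Fin n → ℤ), J = Set.range M.mulVec + (C : Set (Fin n → ℤ))

/-- `J*_0 = ℤⁿ` and `J*_k = R J*_{k-1} + D`. -/
def starSet {n : ℕ} (R : Matrix (Fin n) (Fin n) ℤ) (D : Finset (Fin n → ℤ)) :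
    ℕ → Set (Fin n → ℤ)
  | 0 => Set.univ
  | k + 1 => R.mulVec '' starSet R D k + (D : Set (Fin n → ℤ))

end SelfAffine

namespace SelfAffine

variable {n : ℕ}

/-! Everything rests on `starSet_eq_range_add`, J*_k = R^k ℤⁿ + D_k, and on these sets decreasing.
Put M = R^m, E = D_m. A full-periodic solution of J = MJ + E containing 0 can only be Mℤⁿ + E =
J*_m, and MJ*_m + E = J*_{2m}; so (i) says J*_{2m} = J*_m, which by monotonicity is (iii).
Conversely, stabilisation makes Mℤⁿ + E a solution, and counting residues turns this into a skew
product (`isSkewProductForm_of_range_add_eq`). From a skew product, Mℤⁿ + A solves (i). -/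

lemma digitSum_zero (R : Matrix (Fin n) (Fin n) ℤ) (D : Finset (Fin n → ℤ)) :
    digitSum R D 0 = 0 := by
  simp [digitSum]

lemma digitSum_succ (R : Matrix (Fin n) (Fin n) ℤ) (D : Finset (Fin n → ℤ)) (k : ℕ) :
    digitSum R D (k + 1) = digitSum R D k + D.image (R ^ k).mulVec := by
  simp [digitSum, Finset.sum_range_succ]

lemma zero_mem_digitSum {R : Matrix (Fin n) (Fin n) ℤ} {D : Finset (Fin n → ℤ)} (h0 : 0 ∈ D)
    (k : ℕ) : 0 ∈ digitSum R D k := by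
  induction k with
  | zero => simp [digitSum_zero]
  | succ k ih =>
    rw [digitSum_succ, Finset.mem_add]
    exact ⟨0, ih, 0, Finset.mem_image.2 ⟨0, h0, Matrix.mulVec_zero _⟩, add_zero 0⟩

lemma card_digitSum_le (R : Matrix (Fin n) (Fin n) ℤ) (D : Finset (Fin n → ℤ)) (k : ℕ) :
    (digitSum R D k).card ≤ D.card ^ k := by
  induction k with
  | zero => simp [digitSum_zero]
  | succ k ih =>
    rw [digitSum_succ, pow_succ]
    exact Finset.card_add_le.trans (Nat.mul_le_mul ih Finset.card_image_le)

lemma image_mulVec_add (M : Matrix (Fin n) (Fin n) ℤ) (S T : Set (Fin n → ℤ)) :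
    M.mulVec '' (S + T) = M.mulVec '' S + M.mulVec '' T :=
  Set.image_add M.mulVecLin

lemma starSet_add (R : Matrix (Fin n) (Fin n) ℤ) (D : Finset (Fin n → ℤ)) (k l : ℕ) :
    starSet R D (k + l) =
      (R ^ l).mulVec '' starSet R D k + (digitSum R D l : Set (Fin n → ℤ)) := by
  induction l generalizing k with
  | zero => simp [digitSum_zero]
  | succ l ih =>
    rw [← add_assoc, add_right_comm, ih (k + 1), starSet, image_mulVec_add, digitSum_succ,
      Finset.coe_add, Finset.coe_image, Set.image_image, add_assoc,
      add_comm ((R ^ l).mulVec '' (D : Set (Fin n → ℤ)))]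
    simp only [Matrix.mulVec_mulVec, ← pow_succ]

lemma starSet_eq_range_add (R : Matrix (Fin n) (Fin n) ℤ) (D : Finset (Fin n → ℤ)) (k : ℕ) :
    starSet R D k = Set.range (R ^ k).mulVec + (digitSum R D k : Set (Fin n → ℤ)) := by
  simpa [starSet] using starSet_add R D 0 k

lemma starSet_antitone (R : Matrix (Fin n) (Fin n) ℤ) (D : Finset (Fin n → ℤ)) :
    Antitone (starSet R D) := by
  refine antitone_nat_of_succ_le fun k => ?_
  induction k with
  | zero => exact Set.subset_univ _
  | succ k ih => exact Set.add_subset_add_right (Set.image_mono ih)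

lemma starSet_add_eq_of_succ_eq {R : Matrix (Fin n) (Fin n) ℤ} {D : Finset (Fin n → ℤ)} {m : ℕ}
    (h : starSet R D (m + 1) = starSet R D m) (j : ℕ) :
    starSet R D (m + j) = starSet R D m := by
  induction j with
  | zero => rfl
  | succ j ih => rw [← add_assoc, starSet, ih, ← starSet, h]

/-- A full-periodic solution containing `0` of `J = M J + E` is `M ℤⁿ + E`. -/
lemma eq_range_add_of_isFullPeriodic {M : Matrix (Fin n) (Fin n) ℤ} {E : Finset (Fin n → ℤ)}
    {J : Set (Fin n → ℤ)} (hJ : IsFullPeriodic M J) (h0 : 0 ∈ J)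
    (hJE : J = M.mulVec '' J + (E : Set (Fin n → ℤ))) :
    J = Set.range M.mulVec + (E : Set (Fin n → ℤ)) := by
  obtain ⟨-, C, hC⟩ := hJ
  apply subset_antisymm
  · conv_lhs => rw [hJE]
    exact Set.add_subset_add_right (Set.image_subset_range _ _)
  -- Since 0 ∈ J, the equation gives E ⊆ J; periodicity then absorbs Mℤⁿ.
  · rintro _ ⟨_, ⟨x, rfl⟩, e, he, rfl⟩
    have heJ : e ∈ J := by
      rw [hJE]
      exact ⟨_, ⟨0, h0, Matrix.mulVec_zero M⟩, e, he, zero_add e⟩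
    rw [hC] at heJ ⊢
    obtain ⟨_, ⟨y, rfl⟩, c, hc, rfl⟩ := heJ
    exact ⟨M.mulVec (x + y), ⟨_, rfl⟩, c, hc, by
      simp only [Matrix.mulVec_add]; exact add_assoc _ _ _⟩

lemma natCard_quotient_range_mulVecLin {M : Matrix (Fin n) (Fin n) ℤ} (hM : M.det ≠ 0) :
    Nat.card ((Fin n → ℤ) ⧸ LinearMap.range M.mulVecLin) = M.det.natAbs := by
  have hinj : Function.Injective M.mulVecLin := Matrix.mulVec_injective_of_det_ne_zero hM
  rw [← Submodule.natAbs_det_equiv _ (LinearEquiv.ofInjective M.mulVecLin hinj),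
    ← LinearMap.det_toLin']
  rfl

/-- If `M ℤⁿ + E` solves `J = M J + E`, then `E` is of skew-product-form. -/
lemma isSkewProductForm_of_range_add_eq {M : Matrix (Fin n) (Fin n) ℤ}
    {E : Finset (Fin n → ℤ)} (hM : M.det ≠ 0) (h0 : 0 ∈ E) (hcard : E.card ≤ M.det.natAbs)
    (hJ : Set.range M.mulVec + (E : Set (Fin n → ℤ)) =
      M.mulVec '' (Set.range M.mulVec + (E : Set (Fin n → ℤ))) + (E : Set (Fin n → ℤ))) :
    IsSkewProductForm M E := by
  classical
  have hinj : Function.Injective M.mulVec := Matrix.mulVec_injective_of_det_ne_zero hM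
  let L := LinearMap.range M.mulVecLin
  have hN : Nat.card ((Fin n → ℤ) ⧸ L) = M.det.natAbs := natCard_quotient_range_mulVecLin hM
  have hpos : 0 < M.det.natAbs := Int.natAbs_pos.2 hM
  have : Finite ((Fin n → ℤ) ⧸ L) := Nat.finite_of_card_ne_zero (hN ▸ hpos.ne')
  have := Fintype.ofFinite ((Fin n → ℤ) ⧸ L)
  rw [Nat.card_eq_fintype_card] at hN
  let π : (Fin n → ℤ) → (Fin n → ℤ) ⧸ L := L.mkQ
  have hπ : ∀ x y, π x = π y ↔ ∃ z, x = y + M.mulVec z := fun x y => by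
    refine (Submodule.Quotient.eq L).trans ⟨?_, ?_⟩
    · rintro ⟨z, hz⟩
      exact ⟨z, by rw [← Matrix.mulVecLin_apply, hz]; abel⟩
    · rintro ⟨z, rfl⟩
      exact ⟨z, by simp⟩
  -- A takes one element of E from each class modulo M that E meets; `B a` below records the fibre
  -- over the class of a.
  obtain ⟨A', hA'E, hbij⟩ := Set.exists_subset_bijOn (E : Set (Fin n → ℤ)) π
  have hfin : A'.Finite := E.finite_toSet.subset hA'E
  lift A' to Finset (Fin n → ℤ) using hfin with A
  have hAE : ∀ e ∈ E, ∃ a ∈ A, ∃ z, e = a + M.mulVec z := fun e he => by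
    obtain ⟨a, ha, hae⟩ := hbij.surjOn ⟨e, he, rfl⟩
    exact ⟨a, ha, (hπ _ _).1 hae.symm⟩
  have hAuniq : ∀ a ∈ A, ∀ a' ∈ A, ∀ z z', a + M.mulVec z = a' + M.mulVec z' →
      a = a' ∧ z = z' := by
    intro a ha a' ha' z z' h
    have haa : a = a' := hbij.injOn ha ha' ((hπ _ _).2 ⟨z' - z, by
      rw [Matrix.mulVec_sub, ← add_sub_assoc, ← h]; abel⟩)
    subst haa
    exact ⟨rfl, hinj (add_left_cancel h)⟩
  let B : (Fin n → ℤ) → Finset (Fin n → ℤ) := fun a =>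
    E.preimage (fun b => a + M.mulVec b) fun x _ y _ h => hinj (add_left_cancel h)
  have hB : ∀ a b, b ∈ B a ↔ a + M.mulVec b ∈ E := fun a b => Finset.mem_preimage
  have hEAB : E = A.biUnion fun a => (B a).image fun b => a + M.mulVec b := by
    ext e
    simp only [Finset.mem_biUnion, Finset.mem_image, hB]
    constructor
    · intro he
      obtain ⟨a, ha, z, rfl⟩ := hAE e he
      exact ⟨a, ha, z, he, rfl⟩
    · rintro ⟨a, -, z, hz, rfl⟩
      exact hz
  have hEcard : E.card = ∑ a ∈ A, (B a).card := by
    conv_lhs => rw [hEAB]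
    rw [Finset.card_biUnion]
    · exact Finset.sum_congr rfl fun a _ =>
        Finset.card_image_of_injective _ fun x y h => hinj (add_left_cancel h)
    · intro a ha a' ha' hne
      refine Finset.disjoint_left.2 ?_
      intro x hx hx'
      obtain ⟨b, -, rfl⟩ := Finset.mem_image.1 hx
      obtain ⟨b', -, h⟩ := Finset.mem_image.1 hx'
      exact hne (hAuniq _ ha _ ha' _ _ h.symm).1
  let f : (Fin n → ℤ) × (Fin n → ℤ) → (Fin n → ℤ) ⧸ L := fun p => π (p.1 + p.2)
  -- Expand a + Mx ∈ J as M(My + e') + e. Modulo M, e lies in the class of a, so e = a + Mz with z ∈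
  -- `B a`; cancel a, then M.
  have hsurj : ∀ a ∈ A, ∀ x, ∃ a' ∈ A, ∃ b ∈ B a, ∃ z, x = (a' + b) + M.mulVec z := by
    intro a ha x
    have hx : a + M.mulVec x ∈ Set.range M.mulVec + (E : Set (Fin n → ℤ)) :=
      ⟨_, ⟨x, rfl⟩, a, hA'E ha, add_comm _ _⟩
    rw [hJ] at hx
    obtain ⟨_, ⟨_, ⟨_, ⟨y, rfl⟩, e', he', rfl⟩, rfl⟩, e, he, h⟩ := hx
    obtain ⟨a', ha', z', rfl⟩ := hAE e' he'
    obtain ⟨a₁, ha₁, z, rfl⟩ := hAE e he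
    have h' : a₁ + M.mulVec (M.mulVec y + (a' + M.mulVec z') + z) = a + M.mulVec x := by
      rw [← h, Matrix.mulVec_add _ _ z]
      exact add_left_comm _ _ _
    obtain ⟨rfl, rfl⟩ := hAuniq _ ha₁ _ ha _ _ h'
    exact ⟨a', ha', z, (hB _ _).2 he, y + z', by rw [Matrix.mulVec_add]; abel⟩
  have hsurjOn : ∀ a ∈ A, Set.SurjOn f (A ×ˢ B a : Finset ((Fin n → ℤ) × (Fin n → ℤ)))
      (Finset.univ : Finset ((Fin n → ℤ) ⧸ L)) := by
    rintro a ha q -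
    obtain ⟨x, rfl⟩ := L.mkQ_surjective q
    obtain ⟨a', ha', b, hb, z, hz⟩ := hsurj a ha x
    exact ⟨(a', b), Finset.mem_coe.2 (Finset.mem_product.2 ⟨ha', hb⟩),
      ((hπ _ _).2 ⟨z, hz⟩).symm⟩
  have hge : ∀ a ∈ A, M.det.natAbs ≤ A.card * (B a).card := fun a ha => by
    simpa [hN] using Finset.card_le_card_of_surjOn f (hsurjOn a ha)
  have hsum : ∑ a ∈ A, A.card * (B a).card = A.card * E.card := by
    rw [hEcard, Finset.mul_sum]
  have hconst : ∑ _a ∈ A, M.det.natAbs = A.card * M.det.natAbs := by simp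
  have hAcard : 0 < A.card := by
    obtain ⟨a, ha, -⟩ := hAE 0 h0
    exact Finset.card_pos.2 ⟨a, ha⟩
  -- Summing |det M| ≤ |A||B_a| over a gives |A||det M| ≤ |A||E|. As |E| ≤ |det M|, every inequality
  -- is an equality, so each surjection from A × B_a onto the residues is injective.
  have hle := Finset.sum_le_sum hge
  have heq : ∑ _a ∈ A, M.det.natAbs = ∑ a ∈ A, A.card * (B a).card :=
    hle.antisymm (by rw [hsum, hconst]; exact Nat.mul_le_mul_left _ hcard)
  have hprod := (Finset.sum_eq_sum_iff_of_le hge).1 heq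
  have hfinj : ∀ a ∈ A, Set.InjOn f (A ×ˢ B a : Finset ((Fin n → ℤ) × (Fin n → ℤ))) := fun a ha =>
    Finset.injOn_of_surjOn_of_card_le f (fun _ _ => Finset.mem_coe.2 (Finset.mem_univ _))
      (hsurjOn a ha) (by simp [hN, ← hprod a ha])
  refine ⟨?_, A, B, by simpa only [pow_one] using hEAB, fun a ha => ⟨?_, fun x => ?_⟩⟩
  · rw [hsum, hconst] at heq
    exact (Nat.eq_of_mul_eq_mul_left hAcard heq).symm
  · intro a₁ h₁ a₂ h₂ b₁ hb₁ b₂ hb₂ h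
    exact Prod.ext_iff.1 (hfinj a ha (Finset.mem_coe.2 (Finset.mk_mem_product h₁ hb₁))
      (Finset.mem_coe.2 (Finset.mk_mem_product h₂ hb₂)) (congrArg π h))
  · obtain ⟨a', ha', b, hb, z, hz⟩ := hsurj a ha x
    refine ⟨a' + b, ⟨Finset.add_mem_add ha' hb, z, hz⟩, ?_⟩
    rintro s ⟨hs, z', hz'⟩
    obtain ⟨a₁, h₁, b₁, hb₁, rfl⟩ := Finset.mem_add.1 hs
    have := hfinj a ha (Finset.mem_coe.2 (Finset.mk_mem_product h₁ hb₁))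
      (Finset.mem_coe.2 (Finset.mk_mem_product ha' hb))
      (((hπ _ _).2 ⟨z', hz'⟩).symm.trans ((hπ _ _).2 ⟨z, hz⟩))
    obtain ⟨rfl, rfl⟩ := Prod.ext_iff.1 this
    rfl

/-- If `E` is of skew-product-form with first component `A`, then `J = M ℤⁿ + A` solves
`J = M J + E`. -/
lemma IsSkewProductForm.exists_isFullPeriodic {M : Matrix (Fin n) (Fin n) ℤ}
    {E : Finset (Fin n → ℤ)} (hM : M.det ≠ 0) (h0 : 0 ∈ E) (hE : IsSkewProductForm M E) :
    ∃ J : Set (Fin n → ℤ), IsFullPeriodic M J ∧ 0 ∈ J ∧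
      J = M.mulVec '' J + (E : Set (Fin n → ℤ)) := by
  obtain ⟨-, A, B, hEAB, hAB⟩ := hE
  have hmem : ∀ e, e ∈ E ↔ ∃ a ∈ A, ∃ b ∈ B a, a + M.mulVec b = e := fun e => by
    rw [hEAB]; simp
  refine ⟨Set.range M.mulVec + (A : Set (Fin n → ℤ)), ⟨hM, A, rfl⟩, ?_, subset_antisymm ?_ ?_⟩
  · obtain ⟨a, ha, b, -, h⟩ := (hmem 0).1 h0
    exact ⟨M.mulVec b, ⟨b, rfl⟩, a, ha, by rw [← h]; exact add_comm _ _⟩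
  · rintro _ ⟨_, ⟨x, rfl⟩, a, ha, rfl⟩
    obtain ⟨s, ⟨hs, y, hy⟩, -⟩ := (hAB a ha).2 x
    obtain ⟨a', ha', b, hb, rfl⟩ := Finset.mem_add.1 hs
    refine ⟨_, ⟨M.mulVec y + a', ⟨_, ⟨y, rfl⟩, a', ha', rfl⟩, rfl⟩, a + M.mulVec b,
      (hmem _).2 ⟨a, ha, b, hb, rfl⟩, ?_⟩
    simp only [hy, Matrix.mulVec_add]
    abel
  · rintro _ ⟨_, ⟨x, -, rfl⟩, e, he, rfl⟩
    obtain ⟨a, ha, b, -, rfl⟩ := (hmem e).1 he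
    refine ⟨M.mulVec (x + b), ⟨_, rfl⟩, a, ha, ?_⟩
    simp only [Matrix.mulVec_add]
    abel

end SelfAffine

theorem theorem1p4 {n : ℕ} (R : Matrix (Fin n) (Fin n) ℤ) (hR : SelfAffine.IsExpanding R)
    (D : Finset (Fin n → ℤ)) (hD0 : 0 ∈ D) (hDcard : D.card = R.det.natAbs)
    (hT : SelfAffine.IsSelfAffineTile R D) :
    List.TFAE [
      ∃ m : ℕ, 1 ≤ m ∧ ∃ J : Set (Fin n → ℤ), SelfAffine.IsFullPeriodic (R ^ m) J ∧ 0 ∈ J ∧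
        J = (R ^ m).mulVec '' J + (SelfAffine.digitSum R D m : Set (Fin n → ℤ)),
      ∃ m : ℕ, 1 ≤ m ∧ SelfAffine.IsSkewProductForm (R ^ m) (SelfAffine.digitSum R D m),
      ∃ m : ℕ, 1 ≤ m ∧ SelfAffine.starSet R D (m + 1) = SelfAffine.starSet R D m] := by
  have hdet : R.det ≠ 0 := by
    rw [← Int.natAbs_ne_zero, ← hDcard]
    exact Finset.card_ne_zero_of_mem hD0
  have hdetpow (m : ℕ) : (R ^ m).det ≠ 0 := by
    rw [Matrix.det_pow]
    exact pow_ne_zero m hdet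
  tfae_have 1 → 3 := by
    rintro ⟨m, hm, J, hJ, h0, hJD⟩
    have hJ' := SelfAffine.eq_range_add_of_isFullPeriodic hJ h0 hJD
    rw [← SelfAffine.starSet_eq_range_add] at hJ'
    subst hJ'
    rw [← SelfAffine.starSet_add] at hJD
    refine ⟨m, hm, subset_antisymm (SelfAffine.starSet_antitone R D (Nat.le_succ m)) ?_⟩
    conv_lhs => rw [hJD]
    -- J*_m = J*_{m+m} ⊆ J*_{m+1}, because m ≥ 1.
    exact SelfAffine.starSet_antitone R D (Nat.add_le_add_left hm m)
  tfae_have 3 → 2 := by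
    rintro ⟨m, hm, h⟩
    refine ⟨m, hm, SelfAffine.isSkewProductForm_of_range_add_eq (hdetpow m)
      (SelfAffine.zero_mem_digitSum hD0 m) ?_ ?_⟩
    -- Only an upper bound on |D_m| is needed; equality comes out of the counting.
    · rw [Matrix.det_pow, Int.natAbs_pow, ← hDcard]
      exact SelfAffine.card_digitSum_le R D m
    · rw [← SelfAffine.starSet_eq_range_add, ← SelfAffine.starSet_add,
        SelfAffine.starSet_add_eq_of_succ_eq h]
  tfae_have 2 → 1 := by
    rintro ⟨m, hm, h⟩
    exact ⟨m, hm, h.exists_isFullPeriodic (hdetpow m) (SelfAffine.zero_mem_digitSum hD0 m)⟩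
  tfae_finish
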